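/- Let $K$ and $S$ be compact Hausdorff spaces, and let $C(K)$, $C(S)$ be the Banach spaces of real-valued continuous functions on them with the supremum norm. For $k\in K$ let $\delta_k\in C(K)^*$ be the functional $\delta_k(f)=f(k)$, and similarly $\delta_s\in C(S)^*$ for $s\in S$. Let $T\colon C(K)\to C(S)$ be a linear isometric embedding (not necessarily onto) with adjoint $T^*\colon C(S)^*\to C(K)^*$, and define $F_T\colon S\to C(K)^*$ by $F_T(s)=T^*(\delta_s)$. Call $T$ a U-embedding if for every $x^*\in C(K)^*$ with $\|x^*\|=1$ there is exactly one $y^*\in C(S)^*$ with $T^*(y^*)=x^*$ and $\|y^*\|=\|x^*\|$. Then $T$ is a U-embedding if and only if there exist a closed subset $S_0\subset S$, a homeomorphism $h\colon K\to S_0$ and a continuous function $\varepsilon\colon K\to\{\pm1\}$ such that (i) $F_T(h(k))=\varepsilon(k)\,\delta_k$ for every $k\in K$, and (ii) $\|F_T(s)\|<1$ for every $s\in S\setminus S_0$. -/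

import Mathlib

section

variable {X Y : Type*} [NormedAddCommGroup X] [NormedSpace ℝ X]
  [NormedAddCommGroup Y] [NormedSpace ℝ Y]

/-- The adjoint `T* : Y* → X*` of a linear isometry into `T : X → Y`, given by
`T*(y*) = y* ∘ T`. -/
noncomputable def dualAdjoint (T : X →ₗᵢ[ℝ] Y) : StrongDual ℝ Y →L[ℝ] StrongDual ℝ X :=
  (ContinuousLinearMap.compL ℝ X Y ℝ).flip T.toContinuousLinearMap

@[simp] theorem dualAdjoint_apply (T : X →ₗᵢ[ℝ] Y) (y' : StrongDual ℝ Y) (x : X) :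
    dualAdjoint T y' x = y' (T x) := rfl

/-- `y'` is a Hahn-Banach (that is, norm-preserving) extension of `x'` through `T`. -/
def IsHahnBanachExtension (T : X →ₗᵢ[ℝ] Y) (x' : StrongDual ℝ X) (y' : StrongDual ℝ Y) : Prop :=
  dualAdjoint T y' = x' ∧ ‖y'‖ = ‖x'‖

/-- A linear isometry into is a U-embedding if every functional in the dual unit sphere has a
unique Hahn-Banach extension through it. -/
def IsUEmbedding (T : X →ₗᵢ[ℝ] Y) : Prop :=
  ∀ x' : StrongDual ℝ X, ‖x'‖ = 1 → ∃! y' : StrongDual ℝ Y, IsHahnBanachExtension T x' y'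

/-- The Dirac functional `δ_k ∈ C(K)*`, `f ↦ f k`. -/
noncomputable def diracFunctional {K : Type*} [TopologicalSpace K] [CompactSpace K] (k : K) :
    StrongDual ℝ C(K, ℝ) :=
  ContinuousMap.evalCLM ℝ k

@[simp] theorem diracFunctional_apply {K : Type*} [TopologicalSpace K] [CompactSpace K] (k : K)
    (f : C(K, ℝ)) : diracFunctional k f = f k := rfl

/-- The map `F_T = T* ∘ δ : S → X*` associated with an isometric embedding `T : X → C(S)`. -/
noncomputable def dualRepr {S : Type*} [TopologicalSpace S] [CompactSpace S]
    (T : X →ₗᵢ[ℝ] C(S, ℝ)) (s : S) : StrongDual ℝ X :=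
  dualAdjoint T (diracFunctional s)

end

/-!
By Holsztyński's argument, every `k` admits a point `s` with `F_T(s) = ±δ_k`. For a U-embedding
this point is unique, because `±δ_s` is a norm-preserving extension of `δ_k`; hence `k ↦ s` has
closed graph and is an embedding `h` of `K` into `S`. The operator `R g = (T 1 ∘ h) · (g ∘ h)` is a
left inverse of `T` of norm at most one, so `x* ∘ R` is a norm-preserving extension of `x*`. If
`‖F_T(s)‖ = 1`, uniqueness gives `δ_s = F_T(s) ∘ R`, which only sees values on `h(K)`, so
`s ∈ h(K)`.

Conversely, a functional `y` with `‖T* y‖ = ‖y‖` vanishes on every `g` that is zero wherever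
`‖F_T(s)‖ = 1`, in particular on the kernel of `R`, so that `y = T* y ∘ R`. To see this, choose
`xₙ` in the unit ball such that the deficits `‖y‖ - y(T xₙ)` have a small sum. The deficit bounds
the total variation of `y` on `1 - |T xₙ|`, and the sum of these functions diverges wherever
`‖F_T(s)‖ < 1`, so by compactness some partial sum dominates `|g|` up to a small constant. The total
variation enters only through the Riesz decomposition property of `C(S)`, without any measure.
-/

section LatticeOrderedGroup

variable {α β ι : Type*} [Lattice α] [AddCommGroup α] [IsOrderedAddMonoid α]
  [Lattice β] [AddCommGroup β] [IsOrderedAddMonoid β]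

theorem exists_add_eq_of_abs_le_add {a u v : α} (hu : 0 ≤ u) (hv : 0 ≤ v) (ha : |a| ≤ u + v) :
    ∃ b c, b + c = a ∧ |b| ≤ u ∧ |c| ≤ v := by
  have hle : a - u ≤ v := sub_le_iff_le_add'.2 ((le_abs_self a).trans ha)
  have hge : -(a + u) ≤ v := by
    rw [neg_add', sub_le_iff_le_add']
    exact (neg_le_abs a).trans ha
  refine ⟨a ⊓ u ⊔ -u, a - (a ⊓ u ⊔ -u), add_sub_cancel _ _,
    abs_le'.2 ⟨sup_le inf_le_right (neg_le_self hu), neg_le.2 le_sup_right⟩, ?_⟩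
  have hc : a - (a ⊓ u ⊔ -u) = (0 ⊔ (a - u)) ⊓ (a + u) := by
    rw [sub_sup, sub_inf, sub_self, sub_neg_eq_add]
  rw [hc]
  exact abs_le'.2 ⟨inf_le_left.trans (sup_le hv hle),
    neg_le.2 (le_inf (le_sup_of_le_left (neg_nonpos.2 hv)) (neg_le.2 hge))⟩

theorem abs_map_le_sum_of_abs_le_sum (φ : α →+ β) {u : ι → α} {c : ι → β} (t : Finset ι)
    (hu : ∀ i ∈ t, 0 ≤ u i) (hφ : ∀ i ∈ t, ∀ b, |b| ≤ u i → |φ b| ≤ c i) {a : α}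
    (ha : |a| ≤ ∑ i ∈ t, u i) : |φ a| ≤ ∑ i ∈ t, c i := by
  classical
  induction t using Finset.induction_on generalizing a with
  | empty =>
    rw [Finset.sum_empty] at ha ⊢
    have hzero : a = 0 :=
      le_antisymm ((le_abs_self a).trans ha) (neg_nonpos.1 ((neg_le_abs a).trans ha))
    rw [hzero, map_zero, abs_zero]
  | insert i t hi ih =>
    simp only [Finset.forall_mem_insert] at hu hφ
    rw [Finset.sum_insert hi] at ha ⊢
    obtain ⟨b, b', rfl, hb, hb'⟩ :=
      exists_add_eq_of_abs_le_add hu.1 (Finset.sum_nonneg hu.2) ha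
    rw [map_add]
    exact (abs_add_le _ _).trans (add_le_add (hφ.1 b hb) (ih hu.2 hφ.2 hb'))

end LatticeOrderedGroup

section CompactSpace

theorem continuous_of_isClosed_graph {X Y : Type*} [TopologicalSpace X] [TopologicalSpace Y]
    [CompactSpace Y] {f : X → Y} (hf : IsClosed {p : X × Y | f p.1 = p.2}) : Continuous f := by
  refine continuous_iff_isClosed.2 fun C hC => ?_
  have himage : f ⁻¹' C = Prod.fst '' ({p : X × Y | f p.1 = p.2} ∩ Prod.snd ⁻¹' C) := by
    ext x
    simp
  rw [himage]
  exact isClosedMap_fst_of_compactSpace _ (hf.inter (hC.preimage continuous_snd))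

theorem exists_forall_lt_of_monotone {S ι α : Type*} [TopologicalSpace S] [CompactSpace S]
    [Preorder ι] [Nonempty ι] [IsDirectedOrder ι] [LinearOrder α] [TopologicalSpace α]
    [OrderClosedTopology α] {U : ι → C(S, α)} (hU : Monotone U) {g : C(S, α)}
    (hg : ∀ s, ∃ i, g s < U i s) : ∃ i, ∀ s, g s < U i s := by
  obtain ⟨i, hi⟩ := isCompact_univ.elim_directed_cover (fun i => {s | g s < U i s})
    (fun i => isOpen_lt g.continuous (U i).continuous)
    (fun s _ => Set.mem_iUnion.2 (hg s))
    (directed_of_isDirected_le fun _ _ hij s hs => lt_of_lt_of_le hs (hU hij s))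
  exact ⟨i, fun s => hi (Set.mem_univ s)⟩

theorem exists_forall_norm_apply_eq_norm {S E : Type*} [TopologicalSpace S] [CompactSpace S]
    [Nonempty S] [SeminormedAddCommGroup E] (P : AddSubmonoid C(S, E))
    (hP : ∀ a ∈ P, ∀ b ∈ P, ‖a + b‖ = ‖a‖ + ‖b‖) : ∃ s, ∀ a ∈ P, ‖a s‖ = ‖a‖ := by
  let A (a : P) : Set S := {s | ‖a.1 s‖ = ‖a.1‖}
  have hclosed (a : P) : IsClosed (A a) := isClosed_eq a.1.continuous.norm continuous_const
  have hnonempty (a : P) : (A a).Nonempty := by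
    obtain ⟨s, -, hs⟩ := isCompact_univ.exists_isMaxOn Set.univ_nonempty
      a.1.continuous.norm.continuousOn
    exact ⟨s, le_antisymm (a.1.norm_coe_le_norm s)
      ((ContinuousMap.norm_le _ (norm_nonneg _)).2 fun t => hs (Set.mem_univ t))⟩
  have hdirected : Directed (· ⊇ ·) A := fun a b => by
    refine ⟨a + b, fun s hs => ?_, fun s hs => ?_⟩ <;>
    · have hsum : ‖a.1 s + b.1 s‖ = ‖a.1‖ + ‖b.1‖ := hs.trans (hP _ a.2 _ b.2)
      have htri := norm_add_le (a.1 s) (b.1 s)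
      have ha := a.1.norm_coe_le_norm s
      have hb := b.1.norm_coe_le_norm s
      exact le_antisymm (by assumption) (by linarith)
  obtain ⟨s, hs⟩ := IsCompact.nonempty_iInter_of_directed_nonempty_isCompact_isClosed A
    hdirected hnonempty (fun a => (hclosed a).isCompact) hclosed
  exact ⟨s, fun a ha => Set.mem_iInter.1 hs ⟨a, ha⟩⟩

end CompactSpace

section NormPreservingExtension

variable {X Y : Type*} [NormedAddCommGroup X] [NormedSpace ℝ X]
  [NormedAddCommGroup Y] [NormedSpace ℝ Y] {T : X →ₗᵢ[ℝ] Y} {R : Y →L[ℝ] X}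

theorem exists_norm_le_one_lt_apply_of_lt_norm (x' : StrongDual ℝ X) {r : ℝ} (hr : r < ‖x'‖) :
    ∃ x, ‖x‖ ≤ 1 ∧ r < x' x := by
  obtain ⟨x, hx, hrx⟩ := x'.exists_lt_apply_of_lt_opNorm hr
  rcases lt_abs.1 hrx with h | h
  · exact ⟨x, hx.le, h⟩
  · exact ⟨-x, by rw [norm_neg]; exact hx.le, by rwa [map_neg]⟩

theorem norm_dualAdjoint_le (T : X →ₗᵢ[ℝ] Y) (y' : StrongDual ℝ Y) : ‖dualAdjoint T y'‖ ≤ ‖y'‖ :=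
  ContinuousLinearMap.opNorm_le_bound _ (norm_nonneg _) fun x => by
    rw [← T.norm_map x]
    exact y'.le_opNorm _

theorem isHahnBanachExtension_comp_of_leftInverse (hR : ‖R‖ ≤ 1) (hRT : Function.LeftInverse R T)
    (x' : StrongDual ℝ X) : IsHahnBanachExtension T x' (x'.comp R) := by
  have hadj : dualAdjoint T (x'.comp R) = x' := by
    ext x
    simp [hRT x]
  refine ⟨hadj, le_antisymm ?_ ?_⟩
  · exact (x'.opNorm_comp_le R).trans (mul_le_of_le_one_right (norm_nonneg x') hR)
  · simpa only [hadj] using norm_dualAdjoint_le T (x'.comp R)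

theorem IsUEmbedding.eq_comp_of_leftInverse (hT : IsUEmbedding T) (hR : ‖R‖ ≤ 1)
    (hRT : Function.LeftInverse R T) {y' : StrongDual ℝ Y} (hy' : ‖y'‖ = 1)
    (hTy' : ‖dualAdjoint T y'‖ = 1) : y' = (dualAdjoint T y').comp R :=
  (hT _ hTy').unique ⟨rfl, hy'.trans hTy'.symm⟩
    (isHahnBanachExtension_comp_of_leftInverse hR hRT _)

theorem isUEmbedding_of_leftInverse (hR : ‖R‖ ≤ 1) (hRT : Function.LeftInverse R T)
    (hker : ∀ y', ‖dualAdjoint T y'‖ = ‖y'‖ → ∀ y, R y = 0 → y' y = 0) : IsUEmbedding T := by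
  refine fun x' _ =>
    ⟨x'.comp R, isHahnBanachExtension_comp_of_leftInverse hR hRT x', fun y' hy' => ?_⟩
  ext y
  have hzero := hker y' (hy'.1 ▸ hy'.2.symm) (y - T (R y)) (by rw [map_sub, hRT, sub_self])
  rw [map_sub, sub_eq_zero] at hzero
  rw [hzero, ← hy'.1]
  rfl

end NormPreservingExtension

section Vanishing

variable {S : Type*} [TopologicalSpace S] [CompactSpace S]

theorem one_sub_abs_nonneg_of_norm_le_one {a : C(S, ℝ)} (ha : ‖a‖ ≤ 1) : 0 ≤ 1 - |a| :=
  sub_nonneg.2 fun s => (a.norm_coe_le_norm s).trans ha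

theorem abs_apply_le_norm_sub_apply (y : StrongDual ℝ C(S, ℝ)) {a b : C(S, ℝ)}
    (hab : |b| ≤ 1 - |a|) : |y b| ≤ ‖y‖ - y a := by
  have hnorm {c : C(S, ℝ)} (hc : |c| ≤ 1 - |a|) : ‖a + c‖ ≤ 1 :=
    (ContinuousMap.norm_le _ zero_le_one).2 fun s =>
      (norm_add_le (a s) (c s)).trans (le_sub_iff_add_le'.1 (hc s))
  have happly {c : C(S, ℝ)} (hc : |c| ≤ 1 - |a|) : y a + y c ≤ ‖y‖ := by
    rw [← map_add]
    exact (le_abs_self _).trans (y.unit_le_opNorm _ (hnorm hc))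
  have hpos := happly hab
  have hneg := happly ((abs_neg b).trans_le hab)
  rw [map_neg] at hneg
  exact abs_le.2 ⟨by linarith, by linarith⟩

theorem abs_apply_le_of_abs_le_const_add_sum {ι : Type*} (y : StrongDual ℝ C(S, ℝ))
    {a : ι → C(S, ℝ)} (ha : ∀ i, ‖a i‖ ≤ 1) {g : C(S, ℝ)} {δ : ℝ} (hδ : 0 ≤ δ) (t : Finset ι)
    (hg : |g| ≤ ContinuousMap.const S δ + ∑ i ∈ t, (1 - |a i|)) :
    |y g| ≤ ‖y‖ * δ + ∑ i ∈ t, (‖y‖ - y (a i)) := by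
  have hnonneg (i : ι) : 0 ≤ 1 - |a i| := one_sub_abs_nonneg_of_norm_le_one (ha i)
  obtain ⟨b, c, rfl, hb, hc⟩ := exists_add_eq_of_abs_le_add
    (fun _ => hδ) (Finset.sum_nonneg fun i _ => hnonneg i) hg
  rw [map_add]
  refine (abs_add_le _ _).trans (add_le_add ?_ ?_)
  · exact y.le_opNorm_of_le ((ContinuousMap.norm_le _ hδ).2 hb)
  · exact abs_map_le_sum_of_abs_le_sum (y : C(S, ℝ) →+ ℝ) t (fun i _ => hnonneg i)
      (fun i _ b hb => abs_apply_le_norm_sub_apply y hb) hc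

theorem exists_lt_sum_range_of_forall_le {u : ℕ → ℝ} {r : ℝ} (hr : 0 < r) (hu : ∀ n, r ≤ u n)
    (c : ℝ) : ∃ N, c < ∑ n ∈ Finset.range N, u n := by
  obtain ⟨N, hN⟩ := exists_nat_gt (c / r)
  refine ⟨N, ((div_lt_iff₀ hr).1 hN).trans_le ?_⟩
  simpa using Finset.card_nsmul_le_sum (Finset.range N) u r fun n _ => hu n

theorem apply_eq_zero_of_forall_abs_le_lt_one (y : StrongDual ℝ C(S, ℝ)) {B : Set C(S, ℝ)}
    (hB : ∀ a ∈ B, ‖a‖ ≤ 1) (hy : ∀ r < ‖y‖, ∃ a ∈ B, r < y a) {g : C(S, ℝ)}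
    (hg : ∀ s, g s ≠ 0 → ∃ r < 1, ∀ a ∈ B, |a s| ≤ r) : y g = 0 := by
  suffices hsmall : ∀ δ > 0, |y g| ≤ (‖y‖ + 1) * δ by
    refine abs_nonpos_iff.1 (le_of_forall_pos_le_add fun η hη => ?_)
    have := hsmall (η / (‖y‖ + 1)) (by positivity)
    rwa [mul_div_cancel₀ _ (by positivity), ← zero_add η] at this
  intro δ hδ
  choose a haB hya using fun n : ℕ => hy (‖y‖ - δ / 2 / 2 ^ n) (sub_lt_self _ (by positivity))
  have hlarge (s : S) :
      ∃ N, |g| s < (ContinuousMap.const S δ + ∑ n ∈ Finset.range N, (1 - |a n|)) s := by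
    simp only [ContinuousMap.add_apply, ContinuousMap.const_apply, ContinuousMap.sum_apply]
    by_cases hs : g s = 0
    · exact ⟨0, by simpa [hs] using hδ⟩
    obtain ⟨r, hr, har⟩ := hg s hs
    obtain ⟨N, hN⟩ := exists_lt_sum_range_of_forall_le (u := fun n => (1 - |a n|) s)
      (sub_pos.2 hr) (fun n => sub_le_sub_left (har _ (haB n)) 1) (|g| s)
    exact ⟨N, hN.trans (lt_add_of_pos_left _ hδ)⟩
  obtain ⟨N, hN⟩ := exists_forall_lt_of_monotone (fun M N hMN => add_le_add_right
    (Finset.sum_le_sum_of_subset_of_nonneg (Finset.range_mono hMN) fun n _ _ =>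
      one_sub_abs_nonneg_of_norm_le_one (hB _ (haB n))) _)
    hlarge
  have hdeficit : ∑ n ∈ Finset.range N, (‖y‖ - y (a n)) ≤ δ :=
    (Finset.sum_le_sum fun n _ => sub_le_comm.1 (hya n).le).trans
      (sum_le_hasSum _ (fun n _ => by positivity) (hasSum_geometric_two' δ))
  have hbound := abs_apply_le_of_abs_le_const_add_sum y (fun n => hB _ (haB n)) hδ.le
    (Finset.range N) fun s => (hN s).le
  linarith

variable {X : Type*} [NormedAddCommGroup X] [NormedSpace ℝ X] (T : X →ₗᵢ[ℝ] C(S, ℝ))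

theorem dualRepr_apply (s : S) (x : X) : dualRepr T s x = T x s :=
  rfl

theorem norm_dualRepr_le_one (s : S) : ‖dualRepr T s‖ ≤ 1 :=
  ContinuousLinearMap.opNorm_le_bound _ zero_le_one fun x => by
    rw [one_mul, ← T.norm_map x]
    exact (T x).norm_coe_le_norm s

theorem apply_eq_zero_of_norm_dualAdjoint_eq {y : StrongDual ℝ C(S, ℝ)}
    (hy : ‖dualAdjoint T y‖ = ‖y‖) {g : C(S, ℝ)} (hg : ∀ s, ‖dualRepr T s‖ = 1 → g s = 0) :
    y g = 0 := by
  refine apply_eq_zero_of_forall_abs_le_lt_one y (B := T '' Metric.closedBall 0 1) ?_ ?_ ?_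
  · rintro _ ⟨x, hx, rfl⟩
    rwa [T.norm_map, ← mem_closedBall_zero_iff]
  · intro r hr
    obtain ⟨x, hx, hrx⟩ := exists_norm_le_one_lt_apply_of_lt_norm _ (hr.trans_eq hy.symm)
    exact ⟨T x, ⟨x, mem_closedBall_zero_iff.2 hx, rfl⟩, hrx⟩
  · refine fun s hs => ⟨‖dualRepr T s‖, (norm_dualRepr_le_one T s).lt_of_ne (mt (hg s) hs), ?_⟩
    rintro _ ⟨x, hx, rfl⟩
    exact (dualRepr T s).unit_le_opNorm x (mem_closedBall_zero_iff.1 hx)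

end Vanishing

section DiracFunctional

variable {K : Type*} [TopologicalSpace K] [CompactSpace K]

theorem norm_diracFunctional (k : K) : ‖diracFunctional k‖ = 1 := by
  have : Nonempty K := ⟨k⟩
  refine le_antisymm (ContinuousLinearMap.opNorm_le_bound _ zero_le_one fun f => ?_) ?_
  · rw [one_mul]
    exact f.norm_coe_le_norm k
  · simpa using (diracFunctional k).le_opNorm 1

theorem eq_of_smul_diracFunctional_eq [T2Space K] {k l : K} {c d : ℝ} (hc : c ≠ 0)
    (h : c • diracFunctional k = d • diracFunctional l) : k = l := by
  by_contra hkl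
  obtain ⟨f, hfl, hfk, -⟩ := exists_continuous_zero_one_of_isClosed
    (isClosed_singleton (x := l)) (isClosed_singleton (x := k))
    (Set.disjoint_singleton.2 (Ne.symm hkl))
  have heval : c * f k = d * f l := DFunLike.congr_fun h f
  rw [hfl rfl, hfk rfl] at heval
  exact hc (by simpa using heval)

/-- The cone of functions in `C(K)` that attain their norm, with positive sign, at `k`. It takes the
place of the set of unit vectors `f` with `f k = 1`, so that no normalization is needed. -/
def peakCone (k : K) : AddSubmonoid C(K, ℝ) where
  carrier := {f | f k = ‖f‖}
  zero_mem' := by simp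
  add_mem' {f g} hf hg := le_antisymm ((f + g).apply_le_norm k)
    ((norm_add_le f g).trans_eq (congrArg₂ (· + ·) hf hg).symm)

theorem mem_peakCone {k : K} {f : C(K, ℝ)} : f ∈ peakCone k ↔ f k = ‖f‖ :=
  Iff.rfl

theorem mem_peakCone_of_forall_abs_le {k : K} {f : C(K, ℝ)} (hf : ∀ x, |f x| ≤ f k) :
    f ∈ peakCone k :=
  le_antisymm (f.apply_le_norm k)
    ((ContinuousMap.norm_le _ ((abs_nonneg _).trans (hf k))).2 hf)

theorem one_mem_peakCone (k : K) : (1 : C(K, ℝ)) ∈ peakCone k :=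
  mem_peakCone_of_forall_abs_le fun x => by simp

theorem norm_add_of_mem_peakCone {k : K} {f g : C(K, ℝ)} (hf : f ∈ peakCone k)
    (hg : g ∈ peakCone k) : ‖f + g‖ = ‖f‖ + ‖g‖ :=
  (add_mem hf hg).symm.trans (congrArg₂ (· + ·) hf hg)

theorem exists_mem_peakCone_sub_eq (k : K) (f : C(K, ℝ)) :
    ∃ a ∈ peakCone k, ∃ b ∈ peakCone k, a - b = f := by
  let b : C(K, ℝ) := ContinuousMap.const K (3 * ‖f‖) - |f - ContinuousMap.const K (f k)|
  have hb (x : K) : b x = 3 * ‖f‖ - |f x - f k| := rfl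
  have hbounds (x : K) : -‖f‖ ≤ f x ∧ f x ≤ ‖f‖ := ⟨f.neg_norm_le_apply x, f.apply_le_norm x⟩
  have hk := hbounds k
  refine ⟨f + b, mem_peakCone_of_forall_abs_le fun x => ?_, b,
    mem_peakCone_of_forall_abs_le fun x => ?_, add_sub_cancel_right f b⟩
  all_goals
    have hx := hbounds x
    simp only [ContinuousMap.add_apply, hb, sub_self, abs_zero, sub_zero]
    rcases abs_cases (f x - f k) with ⟨habs, h⟩ | ⟨habs, h⟩ <;>
      exact abs_le.2 ⟨by linarith, by linarith⟩

theorem eq_smul_diracFunctional_of_abs_eq_norm {k : K} {x' : StrongDual ℝ C(K, ℝ)}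
    (hx' : ∀ f ∈ peakCone k, |x' f| = ‖f‖) : x' = x' 1 • diracFunctional k := by
  have hone := one_mem_peakCone k
  have hcone {f : C(K, ℝ)} (hf : f ∈ peakCone k) : x' f = x' 1 * f k := by
    have hunit : |x' 1| = 1 := (hx' 1 hone).trans hone.symm
    have hadd : |x' f + x' 1| = |x' f| + |x' 1| := by
      rw [← map_add, hx' _ (add_mem hf hone), norm_add_of_mem_peakCone hf hone, hx' f hf,
        hx' 1 hone]
    rw [mem_peakCone.1 hf, ← hx' f hf]
    rcases abs_add_eq_add_abs_iff _ _ |>.1 hadd with ⟨hf0, h0⟩ | ⟨hf0, h0⟩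
    · rw [← abs_of_nonneg h0, hunit, one_mul, abs_of_nonneg hf0]
    · rw [← neg_neg (x' 1), ← abs_of_nonpos h0, hunit, neg_one_mul, abs_of_nonpos hf0, neg_neg]
  ext f
  obtain ⟨a, ha, b, hb, rfl⟩ := exists_mem_peakCone_sub_eq k f
  change x' (a - b) = x' 1 * (a k - b k)
  rw [map_sub, hcone ha, hcone hb, mul_sub]

end DiracFunctional

section SignedDirac

variable {K S : Type*} [TopologicalSpace K] [CompactSpace K] [TopologicalSpace S] [CompactSpace S]
  {T : C(K, ℝ) →ₗᵢ[ℝ] C(S, ℝ)}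

/-- `F_T(s) = ±δ_k`. The sign is recovered by evaluating at the constant function `1`, so it is
written as `T 1 s` rather than quantified over. -/
def IsSignedDiracAt (T : C(K, ℝ) →ₗᵢ[ℝ] C(S, ℝ)) (s : S) (k : K) : Prop :=
  |T 1 s| = 1 ∧ dualRepr T s = T 1 s • diracFunctional k

theorem isSignedDiracAt_of_eq_smul {s : S} {k : K} {c : ℝ} (hc : |c| = 1)
    (h : dualRepr T s = c • diracFunctional k) : IsSignedDiracAt T s k := by
  have hsign : T 1 s = c := by
    simpa [dualRepr_apply] using DFunLike.congr_fun h 1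
  exact ⟨hsign ▸ hc, hsign ▸ h⟩

theorem exists_isSignedDiracAt (T : C(K, ℝ) →ₗᵢ[ℝ] C(S, ℝ)) (k : K) :
    ∃ s, IsSignedDiracAt T s k := by
  have : Nonempty K := ⟨k⟩
  have : Nonempty S := by
    by_contra hS
    rw [not_nonempty_iff] at hS
    simpa [Subsingleton.elim (T 1) 0] using T.norm_map 1
  obtain ⟨s, hs⟩ := exists_forall_norm_apply_eq_norm ((peakCone k).map T.toLinearMap) (by
    rintro _ ⟨f, hf, rfl⟩ _ ⟨g, hg, rfl⟩
    change ‖T f + T g‖ = ‖T f‖ + ‖T g‖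
    rw [← map_add, T.norm_map, T.norm_map, T.norm_map, norm_add_of_mem_peakCone hf hg])
  have hnorm (f : C(K, ℝ)) (hf : f ∈ peakCone k) : |T f s| = ‖f‖ :=
    (hs _ ⟨f, hf, rfl⟩).trans (T.norm_map f)
  refine ⟨s, ?_, eq_smul_diracFunctional_of_abs_eq_norm hnorm⟩
  rw [hnorm 1 (one_mem_peakCone k), norm_one]

theorem isClosed_setOf_isSignedDiracAt (T : C(K, ℝ) →ₗᵢ[ℝ] C(S, ℝ)) :
    IsClosed {p : K × S | IsSignedDiracAt T p.2 p.1} := by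
  simp only [IsSignedDiracAt, DFunLike.ext_iff, Set.ofPred_and, Set.ofPred_forall]
  refine (isClosed_eq (by fun_prop) continuous_const).inter
    (isClosed_iInter fun f => isClosed_eq (T f).continuous.snd' ?_)
  change Continuous fun p : K × S => T 1 p.2 * f p.1
  fun_prop

namespace IsSignedDiracAt

variable {s t : S} {k l : K}

theorem apply_one_mul_self (h : IsSignedDiracAt T s k) : T 1 s * T 1 s = 1 := by
  rw [← abs_mul_abs_self, h.1, one_mul]

theorem map_apply (h : IsSignedDiracAt T s k) (f : C(K, ℝ)) : T f s = T 1 s * f k :=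
  DFunLike.congr_fun h.2 f

theorem right_unique [T2Space K] (hk : IsSignedDiracAt T s k) (hl : IsSignedDiracAt T s l) :
    k = l :=
  eq_of_smul_diracFunctional_eq (left_ne_zero_of_mul_eq_one hk.apply_one_mul_self)
    (hk.2.symm.trans hl.2)

theorem isHahnBanachExtension (h : IsSignedDiracAt T s k) :
    IsHahnBanachExtension T (diracFunctional k) (T 1 s • diracFunctional s) := by
  constructor
  · change dualAdjoint T (T 1 s • diracFunctional s) = _
    rw [map_smul]
    change T 1 s • dualRepr T s = _
    rw [h.2, smul_smul, h.apply_one_mul_self, one_smul]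
  · rw [norm_smul, norm_diracFunctional, norm_diracFunctional, mul_one]
    exact h.1

end IsSignedDiracAt

/-- The weighted composition operator `g ↦ ε · (g ∘ h)`. With `ε = T 1 ∘ h`, it inverts an isometry
`T` on the left as soon as `F_T(h(k)) = ±δ_k` for all `k`. -/
noncomputable def weightedComp (ε : C(K, ℝ)) (h : C(K, S)) : C(S, ℝ) →L[ℝ] C(K, ℝ) :=
  LinearMap.mkContinuous
    { toFun := fun g => ε * g.comp h
      map_add' := fun f g => by ext; simp [mul_add]
      map_smul' := fun c f => by ext; simp } ‖ε‖ fun g =>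
    (norm_mul_le _ _).trans <| mul_le_mul_of_nonneg_left
      ((ContinuousMap.norm_le _ (norm_nonneg g)).2 fun _ => g.norm_coe_le_norm _) (norm_nonneg ε)

theorem weightedComp_apply (ε : C(K, ℝ)) (h : C(K, S)) (g : C(S, ℝ)) (k : K) :
    weightedComp ε h g k = ε k * g (h k) :=
  rfl

theorem norm_weightedComp_le (ε : C(K, ℝ)) (h : C(K, S)) : ‖weightedComp ε h‖ ≤ ‖ε‖ :=
  LinearMap.mkContinuous_norm_le _ (norm_nonneg ε) _

variable {h : C(K, S)}

theorem norm_weightedComp_le_one (hh : ∀ k, IsSignedDiracAt T (h k) k) :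
    ‖weightedComp ((T 1).comp h) h‖ ≤ 1 :=
  (norm_weightedComp_le _ h).trans
    ((ContinuousMap.norm_le _ zero_le_one).2 fun k => (hh k).1.le)

theorem leftInverse_weightedComp (hh : ∀ k, IsSignedDiracAt T (h k) k) :
    Function.LeftInverse (weightedComp ((T 1).comp h) h) T := fun f => by
  ext k
  rw [weightedComp_apply, (hh k).map_apply, ContinuousMap.comp_apply, ← mul_assoc,
    (hh k).apply_one_mul_self, one_mul]

theorem isUEmbedding_of_isSignedDiracAt (hh : ∀ k, IsSignedDiracAt T (h k) k)
    (hlt : ∀ s, s ∉ Set.range h → ‖dualRepr T s‖ < 1) : IsUEmbedding T := by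
  refine isUEmbedding_of_leftInverse (norm_weightedComp_le_one hh) (leftInverse_weightedComp hh)
    fun y hy g hg => apply_eq_zero_of_norm_dualAdjoint_eq T hy fun s hs => ?_
  obtain ⟨k, rfl⟩ : s ∈ Set.range h := by
    by_contra hmem
    exact (hlt s hmem).ne hs
  have hzero : T 1 (h k) * g (h k) = 0 := DFunLike.congr_fun hg k
  exact (mul_eq_zero.1 hzero).resolve_left
    (left_ne_zero_of_mul_eq_one (hh k).apply_one_mul_self)

namespace IsUEmbedding

theorem eq_of_isSignedDiracAt [T2Space S] (hT : IsUEmbedding T) {s t : S} {k : K}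
    (hs : IsSignedDiracAt T s k) (ht : IsSignedDiracAt T t k) : s = t :=
  eq_of_smul_diracFunctional_eq (left_ne_zero_of_mul_eq_one hs.apply_one_mul_self)
    ((hT _ (norm_diracFunctional k)).unique hs.isHahnBanachExtension ht.isHahnBanachExtension)

theorem exists_continuousMap_isSignedDiracAt [T2Space S] (hT : IsUEmbedding T) :
    ∃ h : C(K, S), ∀ k, IsSignedDiracAt T (h k) k := by
  choose h hh using exists_isSignedDiracAt T
  have hgraph : {p : K × S | h p.1 = p.2} = {p | IsSignedDiracAt T p.2 p.1} := by
    ext ⟨k, s⟩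
    exact ⟨fun (hs : h k = s) => hs ▸ hh k, hT.eq_of_isSignedDiracAt (hh k)⟩
  exact ⟨⟨h, continuous_of_isClosed_graph (hgraph ▸ isClosed_setOf_isSignedDiracAt T)⟩, hh⟩

theorem norm_dualRepr_lt_one [T2Space S] (hT : IsUEmbedding T)
    (hh : ∀ k, IsSignedDiracAt T (h k) k) {s : S} (hs : s ∉ Set.range h) :
    ‖dualRepr T s‖ < 1 := by
  refine (norm_dualRepr_le_one T s).lt_of_ne fun hnorm => ?_
  have hext := hT.eq_comp_of_leftInverse (norm_weightedComp_le_one hh)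
    (leftInverse_weightedComp hh) (norm_diracFunctional s) hnorm
  obtain ⟨g, hgh, hgs, -⟩ := exists_continuous_zero_one_of_isClosed
    (isCompact_range h.continuous).isClosed (isClosed_singleton (x := s))
    (Set.disjoint_singleton_right.2 hs)
  have hzero : weightedComp ((T 1).comp h) h g = 0 := by
    ext k
    rw [weightedComp_apply, hgh ⟨k, rfl⟩]
    simp
  have heval : g s = dualRepr T s (weightedComp ((T 1).comp h) h g) := DFunLike.congr_fun hext g
  rw [hgs rfl, hzero, map_zero] at heval
  exact one_ne_zero heval

end IsUEmbedding

end SignedDirac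

theorem mainTheorem1 {K S : Type*}
    [TopologicalSpace K] [CompactSpace K] [T2Space K]
    [TopologicalSpace S] [CompactSpace S] [T2Space S]
    (T : C(K, ℝ) →ₗᵢ[ℝ] C(S, ℝ)) :
    IsUEmbedding T ↔
      ∃ S₀ : Set S, IsClosed S₀ ∧
        ∃ (h : K ≃ₜ S₀) (ε : K → ℝ),
          Continuous ε ∧ (∀ k, ε k = 1 ∨ ε k = -1) ∧
          (∀ k, dualRepr T (h k : S) = ε k • diracFunctional k) ∧
          (∀ s, s ∉ S₀ → ‖dualRepr T s‖ < 1) := by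
  constructor
  · intro hT
    obtain ⟨h, hh⟩ := hT.exists_continuousMap_isSignedDiracAt
    have hinj : Function.Injective h := fun k l hkl => (hh k).right_unique (hkl ▸ hh l)
    have hemb := h.continuous.isClosedEmbedding hinj
    exact ⟨Set.range h, hemb.isClosed_range, hemb.isEmbedding.toHomeomorph, fun k => T 1 (h k),
      by fun_prop, fun k => eq_or_eq_neg_of_abs_eq (hh k).1, fun k => (hh k).2,
      fun s hs => hT.norm_dualRepr_lt_one hh hs⟩
  · rintro ⟨S₀, -, h, ε, -, hε, hrep, hlt⟩
    refine isUEmbedding_of_isSignedDiracAt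
      (h := ⟨fun k => h k, continuous_subtype_val.comp h.continuous⟩)
      (fun k => isSignedDiracAt_of_eq_smul ((abs_eq zero_le_one).2 (hε k)) (hrep k))
      fun s hs => hlt s fun hmem => hs ⟨h.symm ⟨s, hmem⟩, by simp⟩
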